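/- Let $\mathcal S=\mathcal S(\mathbb R)$ be the real Schwartz space with its Fréchet topology, $\mathcal S'$ its dual (real tempered distributions) with the Borel $\sigma$-algebra of the weak-$*$ topology, and $X_s(\omega)=\langle\omega,s\rangle$ for $s\in\mathcal S$, $\omega\in\mathcal S'$. Let $\mathcal N:\mathcal S\to\mathbb R$ be continuous, conditionally negative definite (that is, $\sum_{j,k}c_j\overline{c_k}\,\mathcal N(s_j-s_k)\le 0$ for all $s_1,\dots,s_n\in\mathcal S$ and $c_1,\dots,c_n\in\mathbb C$ with $\sum_j c_j=0$), and such that $\mathcal N(\alpha s)=\alpha^2\mathcal N(s)$ for all $\alpha\in\mathbb R$, $s\in\mathcal S$. Let $\mathcal H$ be the real reproducing kernel Hilbert space on $\mathcal S$ with kernel $\varphi_{\mathcal N}(s,t)=\tfrac12\big(\mathcal N(s)+\mathcal N(t)-\mathcal N(s-t)\big)$, and put $\varphi_s=\varphi_{\mathcal N}(s,\cdot)\in\mathcal H$. For $\lambda>0$ let $\mathcal H_\lambda$ be $\mathcal H$ with the inner product $\lambda^2\langle\cdot,\cdot\rangle_{\mathcal H}$, and let $\mathbb P_\lambda$ be the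 probability measure on $\mathcal S'$ with $\mathbb E_{\mathbb P_\lambda}[e^{iX_s}]=e^{-\lambda^2\mathcal N(s)/2}$ for all $s\in\mathcal S$. Let $\Gamma_{sym}(\mathcal H_\lambda)$ be the complex symmetric Fock space over (the complexification of) $\mathcal H_\lambda$, i.e. the subspace of symmetric tensors of the Hilbert space direct sum $\bigoplus_{n\ge0}\mathcal H_\lambda^{\otimes n}$, and let $\varepsilon(h)=\sum_{n\ge0}h^{\otimes n}/\sqrt{n!}$. Then for every $\lambda>0$ the complex Hilbert spaces $\Gamma_{sym}(\mathcal H_\lambda)$ and $L_2(\mathcal S',\mathbb P_\lambda)$ are isometrically isomorphic. More explicitly, there is a unique linear isometric isomorphism $W_\lambda$ of $\Gamma_{sym}(\mathcal H_\lambda)$ onto $L_2(\mathcal S',\mathbb P_\lambda)$ such that $$W_\lambda(\varepsilon(\varphi_s))=\exp\Big\{X_s-\tfrac12\|\varphi_s\|_{\mathcal H_\lambda}^2\Big\}=\exp\Big\{X_s-\tfrac12\lambda^2\mathcal N(s)\Big\}\qquad\text{for all } s\in\mathcal S.$$ On the other hand, if $\mathcal N$ is not identically zero, there is no linear isometry $V:\Gamma_{sym}(\mathcal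 H_\lambda)\to L_2(\mathcal S',\mathbb P_\lambda)$ with $V(\varepsilon(\varphi_s))=\exp\{X_s/\sqrt2\}$ for all $s\in\mathcal S$. -/

import Mathlib

open MeasureTheory
open scoped TensorProduct SchwartzMap

namespace WhiteNoise

noncomputable section

/-! ### The Schwartz space, tempered distributions, and the function `N` -/

/-- The real Schwartz space `S = S(ℝ)`, with its Fréchet topology. -/
abbrev S : Type := 𝓢(ℝ, ℝ)

/-- The space `S'` of (real) tempered distributions: continuous linear functionals on `S`,
with the weak-* topology. -/
abbrev TemperedDual : Type := WeakDual ℝ S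

/-- `S'` carries its Borel σ-algebra. -/
instance instMeasurableSpaceTemperedDual : MeasurableSpace TemperedDual :=
  borel TemperedDual

instance instBorelSpaceTemperedDual : BorelSpace TemperedDual := ⟨rfl⟩

open scoped ComplexOrder in
/-- A function `f : X → ℝ` on an additive group is conditionally negative definite if
`∑ⱼₖ cⱼ c̄ₖ f (xⱼ - xₖ) ≤ 0` (in particular, the sum is real) whenever `∑ⱼ cⱼ = 0`. -/
def IsCND {X : Type*} [AddGroup X] (f : X → ℝ) : Prop :=
  ∀ (n : ℕ) (x : Fin n → X) (c : Fin n → ℂ), ∑ j, c j = 0 →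
    ∑ j, ∑ k, c j * star (c k) * (f (x j - x k) : ℂ) ≤ 0

/-- The functions `N : S → ℝ` under consideration: conditionally negative definite, continuous
for the Fréchet topology, and with `N (α s) = α ^ 2 N s`. -/
structure GaussianCND where
  /-- the underlying function -/
  toFun : S → ℝ
  cnd : IsCND toFun
  continuous_toFun : Continuous toFun
  map_smul' : ∀ (α : ℝ) (s : S), toFun (α • s) = α ^ 2 * toFun s

instance : CoeFun GaussianCND (fun _ => S → ℝ) := ⟨GaussianCND.toFun⟩

/-! ### The reproducing kernel Hilbert space of `N` -/

/-- The kernel `φ_N(s, t) = (N s + N t - N (s - t)) / 2`. -/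
def cndKernel (N : GaussianCND) (s t : S) : ℝ := (N s + N t - N (s - t)) / 2

/-- The kernel `φ_N` as an operator-valued matrix (a real number acts on `ℝ` by multiplication). -/
def kernelMatrix (N : GaussianCND) : Matrix S S (ℝ →L[ℝ] ℝ) :=
  Matrix.of fun s t => cndKernel N s t • ContinuousLinearMap.id ℝ ℝ

theorem GaussianCND.map_zero (N : GaussianCND) : N 0 = 0 := by
  simpa using N.map_smul' 0 0

theorem GaussianCND.map_neg (N : GaussianCND) (s : S) : N (-s) = N s := by
  simpa using N.map_smul' (-1) s

theorem GaussianCND.map_sub_comm (N : GaussianCND) (s t : S) : N (s - t) = N (t - s) := by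
  rw [← GaussianCND.map_neg N, neg_sub]

theorem GaussianCND.cnd_real (N : GaussianCND) {ι : Type*} [Fintype ι] (x : ι → S) (c : ι → ℝ)
    (hc : ∑ i, c i = 0) : ∑ i, ∑ j, c i * c j * N (x i - x j) ≤ 0 := by
  classical
  let e := Fintype.equivFin ι
  have h := N.cnd (Fintype.card ι) (fun i => x (e.symm i)) (fun i => (c (e.symm i) : ℂ))
    (by rw [e.symm.sum_comp (fun i => (c i : ℂ))]; exact_mod_cast hc)
  have h2 : ∑ j, ∑ k, (c (e.symm j) : ℂ) * star (c (e.symm k) : ℂ)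
      * (N (x (e.symm j) - x (e.symm k)) : ℂ)
      = ((∑ i, ∑ j, c i * c j * N (x i - x j) : ℝ) : ℂ) := by
    rw [e.symm.sum_comp (fun j => ∑ k, (c j : ℂ) * star (c (e.symm k) : ℂ)
      * (N (x j - x (e.symm k)) : ℂ))]
    push_cast
    refine Finset.sum_congr rfl fun j _ => ?_
    rw [e.symm.sum_comp (fun k => (c j : ℂ) * star (c k : ℂ) * (N (x j - x k) : ℂ))]
    simp
  rw [h2] at h
  exact_mod_cast h

theorem cndKernel_nonneg (N : GaussianCND) {ι : Type*} [Fintype ι] (x : ι → S) (c : ι → ℝ) :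
    0 ≤ ∑ i, ∑ j, c i * c j * cndKernel N (x i) (x j) := by
  have h := GaussianCND.cnd_real N (fun o : Option ι => o.elim 0 x) (fun o => o.elim (-∑ i, c i) c)
    (by simp [Fintype.sum_option])
  simp only [Fintype.sum_option, Option.elim, sub_zero, zero_sub, GaussianCND.map_zero, GaussianCND.map_neg,
    Finset.sum_add_distrib] at h
  have h3 : ∑ i, ∑ j, c i * c j * cndKernel N (x i) (x j)
      = (∑ i, c i) * (∑ i, c i * N (x i))
        - (∑ i, ∑ j, c i * c j * N (x i - x j)) / 2 := by
    have e1 : ∑ i, ∑ j, c i * c j * N (x i) = (∑ i, c i) * (∑ i, c i * N (x i)) := by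
      rw [mul_comm, Finset.sum_mul_sum]
      exact Finset.sum_congr rfl fun i _ => Finset.sum_congr rfl fun j _ => by ring
    have e2 : ∑ i, ∑ j, c i * c j * N (x j) = (∑ i, c i) * (∑ i, c i * N (x i)) := by
      rw [Finset.sum_mul_sum]
      exact Finset.sum_congr rfl fun i _ => Finset.sum_congr rfl fun j _ => by ring
    calc _ = (∑ i, ∑ j, c i * c j * N (x i) + ∑ i, ∑ j, c i * c j * N (x j)
            - ∑ i, ∑ j, c i * c j * N (x i - x j)) / 2 := by
          simp only [← Finset.sum_add_distrib, ← Finset.sum_sub_distrib, Finset.sum_div]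
          exact Finset.sum_congr rfl fun i _ => Finset.sum_congr rfl fun j _ => by
            rw [cndKernel]; ring
      _ = _ := by rw [e1, e2]; ring
  have e3 : ∑ i, (-∑ i, c i) * c i * N (x i) = -((∑ i, c i) * ∑ i, c i * N (x i)) := by
    rw [← neg_mul, Finset.mul_sum]
    exact Finset.sum_congr rfl fun i _ => by ring
  have e4 : ∑ i, c i * (-∑ i, c i) * N (x i) = -((∑ i, c i) * ∑ i, c i * N (x i)) := by
    rw [← neg_mul, Finset.mul_sum]
    exact Finset.sum_congr rfl fun i _ => by ring
  rw [e3, e4] at h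
  rw [h3]
  linarith

instance instFactPosSemidef (N : GaussianCND) : Fact (kernelMatrix N).PosSemidef := by
  refine Fact.mk ((RKHS.posSemidef_tfae.out 0 2).mpr (And.intro ?_ fun v => ?_))
  · ext s t
    simp [kernelMatrix, cndKernel, Matrix.conjTranspose_apply, ← ContinuousLinearMap.one_def,
      GaussianCND.map_sub_comm N s t, add_comm]
  · have h := cndKernel_nonneg N (fun i : v.support => (i : S)) (fun i => v i)
    simp only [Finsupp.sum, kernelMatrix, Matrix.of_apply, RCLike.re_to_real]
    rw [← Finset.sum_coe_sort]
    refine h.trans (le_of_eq ?_)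
    refine Finset.sum_congr rfl fun i _ => ?_
    refine (Finset.sum_coe_sort v.support
      (fun a => v i * v a * cndKernel N (i : S) a)).trans ?_
    refine Finset.sum_congr rfl fun j _ => ?_
    simp [cndKernel, GaussianCND.map_sub_comm N (i : S) j]
    ring

/-- The real Hilbert space `H`: the reproducing kernel Hilbert space on `S` with kernel `φ_N`. -/
abbrev H (N : GaussianCND) : Type := RKHS.OfKernel (kernelMatrix N)

/-- The element `φ_s ∈ H`, i.e. the function `t ↦ φ_N(s, t)`. -/
def phi (N : GaussianCND) (s : S) : H N := RKHS.kerFun (H N) s 1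

theorem phi_apply (N : GaussianCND) (s t : S) : phi N s t = cndKernel N s t := by
  rw [phi, RKHS.kerFun_apply, RKHS.OfKernel.kernel_ofKernel]
  simp [kernelMatrix, cndKernel, GaussianCND.map_sub_comm N s t, add_comm]

theorem inner_phi (N : GaussianCND) (s t : S) :
    inner ℝ (phi N s) (phi N t) = cndKernel N s t := by
  conv_lhs => rw [phi, RKHS.kerFun_inner, phi_apply]
  simp [cndKernel, GaussianCND.map_sub_comm N s t, add_comm]

/-! ### Rescaling a real Hilbert space -/

/-- For `lam > 0`, the real vector space `V` with the inner product multiplied by `lam ^ 2`. -/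
def Scaled (_lam : {r : ℝ // 0 < r}) (V : Type*) : Type _ := V

section Scaled

variable {V : Type*} [NormedAddCommGroup V] [InnerProductSpace ℝ V] (lam : {r : ℝ // 0 < r})

instance : AddCommGroup (Scaled lam V) := inferInstanceAs (AddCommGroup V)

instance : Module ℝ (Scaled lam V) := inferInstanceAs (Module ℝ V)

/-- The identity map `V → Scaled lam V`. -/
def toScaled : V ≃ₗ[ℝ] Scaled lam V := LinearEquiv.refl ℝ V

/-- The inner product `⟨x, y⟩ = lam ^ 2 ⟨x, y⟩_V`. -/
@[reducible]
def scaledCore : InnerProductSpace.Core ℝ (Scaled lam V) where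
  inner x y := (lam : ℝ) ^ 2 * inner ℝ ((toScaled lam).symm x) ((toScaled lam).symm y)
  conj_inner_symm x y := by simp [real_inner_comm]
  re_inner_nonneg x := mul_nonneg (sq_nonneg _) real_inner_self_nonneg
  add_left x y z := by simp [inner_add_left, mul_add]
  smul_left x y r := by simp [real_inner_smul_left]; ring
  definite x hx := by
    have h : (lam : ℝ) ^ 2 ≠ 0 := pow_ne_zero _ lam.2.ne'
    have h2 := (mul_eq_zero.mp hx).resolve_left h
    exact (toScaled lam).symm.map_eq_zero_iff.mp (inner_self_eq_zero.mp h2)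

instance : NormedAddCommGroup (Scaled lam V) :=
  (scaledCore lam).toNormedAddCommGroup

instance : InnerProductSpace ℝ (Scaled lam V) :=
  InnerProductSpace.ofCore (scaledCore lam).toCore

theorem inner_toScaled (x y : V) :
    inner ℝ (toScaled lam x) (toScaled lam y) = (lam : ℝ) ^ 2 * inner ℝ x y := rfl

end Scaled

/-! ### Complexification of a real Hilbert space -/

/-- The complexification of a real vector space: formal sums `re + i im`. -/
@[ext]
structure Complexification (V : Type*) where
  re : V
  im : V

namespace Complexification

variable {V : Type*}

/-- `V_ℂ ≃ V × V`. -/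
def equivProd : Complexification V ≃ V × V where
  toFun x := (x.re, x.im)
  invFun p := ⟨p.1, p.2⟩
  left_inv _ := rfl
  right_inv _ := rfl

variable [NormedAddCommGroup V]

instance : AddCommGroup (Complexification V) := equivProd.addCommGroup

@[simp] theorem add_re (x y : Complexification V) : (x + y).re = x.re + y.re := rfl
@[simp] theorem add_im (x y : Complexification V) : (x + y).im = x.im + y.im := rfl
@[simp] theorem zero_re : (0 : Complexification V).re = 0 := rfl
@[simp] theorem zero_im : (0 : Complexification V).im = 0 := rfl

variable [InnerProductSpace ℝ V]

/-- `(a + i b) (x + i y) = (a x - b y) + i (a y + b x)`. -/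
instance : SMul ℂ (Complexification V) where
  smul z x := ⟨z.re • x.re - z.im • x.im, z.re • x.im + z.im • x.re⟩

@[simp] theorem smul_re (z : ℂ) (x : Complexification V) :
    (z • x).re = z.re • x.re - z.im • x.im := rfl
@[simp] theorem smul_im (z : ℂ) (x : Complexification V) :
    (z • x).im = z.re • x.im + z.im • x.re := rfl

instance : Module ℂ (Complexification V) where
  one_smul x := by ext <;> simp
  mul_smul z w x := by ext <;> simp <;> module
  smul_zero z := by ext <;> simp
  smul_add z x y := by ext <;> simp <;> module
  add_smul z w x := by ext <;> simp <;> module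
  zero_smul x := by ext <;> simp

/-- `⟨x + i y, x' + i y'⟩ = ⟨x, x'⟩ + ⟨y, y'⟩ + i (⟨x, y'⟩ - ⟨y, x'⟩)`, conjugate-linear in the
first variable. -/
@[reducible]
def complexCore : InnerProductSpace.Core ℂ (Complexification V) where
  inner x y := ⟨inner ℝ x.re y.re + inner ℝ x.im y.im, inner ℝ x.re y.im - inner ℝ x.im y.re⟩
  conj_inner_symm x y := by
    apply Complex.ext <;> simp [real_inner_comm]
  re_inner_nonneg x := add_nonneg real_inner_self_nonneg real_inner_self_nonneg
  add_left x y z := by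
    apply Complex.ext <;> simp [inner_add_left] <;> ring
  smul_left x y r := by
    apply Complex.ext <;>
      simp [inner_add_left, inner_sub_left, real_inner_smul_left] <;> ring
  definite x hx := by
    have h : inner ℝ x.re x.re + inner ℝ x.im x.im = 0 := congrArg Complex.re hx
    have h1 : 0 ≤ inner ℝ x.re x.re := real_inner_self_nonneg
    have h2 : 0 ≤ inner ℝ x.im x.im := real_inner_self_nonneg
    ext
    · exact inner_self_eq_zero.mp (by linarith : inner ℝ x.re x.re = 0)
    · exact inner_self_eq_zero.mp (by linarith : inner ℝ x.im x.im = 0)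

instance : NormedAddCommGroup (Complexification V) :=
  complexCore.toNormedAddCommGroup

instance : InnerProductSpace ℂ (Complexification V) :=
  InnerProductSpace.ofCore complexCore.toCore

/-- The inclusion `V → V_ℂ`, `x ↦ x + i 0`. -/
def ofReal (x : V) : Complexification V := ⟨x, 0⟩

theorem inner_ofReal (x y : V) : inner ℂ (ofReal x) (ofReal y) = (inner ℝ x y : ℂ) := by
  change (⟨_, _⟩ : ℂ) = _
  apply Complex.ext <;> simp [ofReal]

end Complexification

/-! ### Hilbert space tensor powers -/

section Fock

variable (E : Type*) [NormedAddCommGroup E] [InnerProductSpace ℂ E]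

/-- The algebraic `n`-fold tensor power of `E` over `ℂ`. -/
def AlgTensorPower (n : ℕ) : Type _ := ⨂[ℂ]^n E

instance (n : ℕ) : AddCommGroup (AlgTensorPower E n) := inferInstanceAs (AddCommGroup (⨂[ℂ]^n E))

instance (n : ℕ) : Module ℂ (AlgTensorPower E n) := inferInstanceAs (Module ℂ (⨂[ℂ]^n E))

variable {E}

/-- The elementary tensor `u₁ ⊗ ⋯ ⊗ uₙ`. -/
def pureTensor (n : ℕ) : MultilinearMap ℂ (fun _ : Fin n => E) (AlgTensorPower E n) :=
  PiTensorProduct.tprod ℂ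

/-- The linear functional `u₁ ⊗ ⋯ ⊗ uₙ ↦ ∏ᵢ ⟨vᵢ, uᵢ⟩`. -/
def tensorFunctional {n : ℕ} (v : Fin n → E) : AlgTensorPower E n →ₗ[ℂ] ℂ :=
  PiTensorProduct.lift
    ((MultilinearMap.mkPiAlgebra ℂ (Fin n) ℂ).compLinearMap fun i => innerₛₗ ℂ (v i))

theorem tensorFunctional_pureTensor {n : ℕ} (v u : Fin n → E) :
    tensorFunctional v (pureTensor n u) = ∏ i, inner ℂ (v i) (u i) := by
  refine (PiTensorProduct.lift.tprod u).trans ?_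
  simp

theorem span_pureTensor (n : ℕ) :
    Submodule.span ℂ (Set.range (pureTensor (E := E) n)) = ⊤ :=
  PiTensorProduct.span_tprod_eq_top

theorem tensor_induction {n : ℕ} {p : AlgTensorPower E n → Prop} (x : AlgTensorPower E n)
    (h0 : p 0) (hadd : ∀ x y, p x → p y → p (x + y)) (hsmul : ∀ (c : ℂ) x, p x → p (c • x))
    (hpure : ∀ u, p (pureTensor n u)) : p x := by
  have hx : x ∈ Submodule.span ℂ (Set.range (pureTensor (E := E) n)) := by
    rw [span_pureTensor]; trivial
  induction hx using Submodule.span_induction with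
  | mem x h => obtain ⟨u, rfl⟩ := h; exact hpure u
  | zero => exact h0
  | add x y _ _ hx hy => exact hadd x y hx hy
  | smul c x _ hx => exact hsmul c x hx

theorem tensorFunctional_update_add {n : ℕ} [DecidableEq (Fin n)] (v : Fin n → E) (i : Fin n)
    (a b : E) (x : AlgTensorPower E n) :
    tensorFunctional (Function.update v i (a + b)) x
      = tensorFunctional (Function.update v i a) x
        + tensorFunctional (Function.update v i b) x := by
  induction x using tensor_induction with
  | h0 => simp
  | hadd x y hx hy => simp only [LinearMap.map_add, hx, hy]; ring
  | hsmul c x hx => simp only [LinearMap.map_smul, hx, smul_add]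
  | hpure u =>
    simp only [tensorFunctional_pureTensor, ← Finset.mul_prod_erase _ _ (Finset.mem_univ i),
      Function.update_self, inner_add_left, add_mul]
    congr 2 <;> exact Finset.prod_congr rfl fun j hj => by
      simp [Function.update_of_ne (Finset.ne_of_mem_erase hj)]

theorem tensorFunctional_update_smul {n : ℕ} [DecidableEq (Fin n)] (v : Fin n → E) (i : Fin n)
    (c : ℂ) (a : E) (x : AlgTensorPower E n) :
    tensorFunctional (Function.update v i (c • a)) x
      = star c * tensorFunctional (Function.update v i a) x := by
  induction x using tensor_induction with
  | h0 => simp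
  | hadd x y hx hy => simp only [LinearMap.map_add, hx, hy]; ring
  | hsmul d x hx => simp only [LinearMap.map_smul, hx, smul_eq_mul]; ring
  | hpure u =>
    simp only [tensorFunctional_pureTensor, ← Finset.mul_prod_erase _ _ (Finset.mem_univ i),
      Function.update_self, inner_smul_left, mul_assoc]
    congr 2
    exact Finset.prod_congr rfl fun j hj => by
      simp [Function.update_of_ne (Finset.ne_of_mem_erase hj)]

/-- Auxiliary to the inner product: `v ↦ (x ↦ conj (tensorFunctional v x))` as a multilinear map
with values in conjugate-linear functionals. -/
def tensorSesqAux (n : ℕ) :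
    MultilinearMap ℂ (fun _ : Fin n => E) (AlgTensorPower E n →ₗ⋆[ℂ] ℂ) where
  toFun v :=
    { toFun := fun x => star (tensorFunctional v x)
      map_add' := fun x y => by simp
      map_smul' := fun c x => by simp }
  map_update_add' v i a b := by
    ext x; simp [tensorFunctional_update_add]
  map_update_smul' v i c a := by
    ext x; simp [tensorFunctional_update_smul]

/-- The sesquilinear form on the algebraic tensor power (linear in the first argument,
conjugate-linear in the second). -/
def tensorSesq (n : ℕ) : AlgTensorPower E n →ₗ[ℂ] (AlgTensorPower E n →ₗ⋆[ℂ] ℂ) :=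
  PiTensorProduct.lift (tensorSesqAux n)

theorem tensorSesq_pureTensor {n : ℕ} (v u : Fin n → E) :
    tensorSesq n (pureTensor n v) (pureTensor n u) = ∏ i, inner ℂ (u i) (v i) := by
  have h : tensorSesq n (pureTensor n v) = tensorSesqAux n v :=
    PiTensorProduct.lift.tprod v
  rw [h]
  change star (tensorFunctional v (pureTensor n u)) = _
  rw [tensorFunctional_pureTensor]
  simp

theorem tensorSesq_symm {n : ℕ} (x y : AlgTensorPower E n) :
    star (tensorSesq n x y) = tensorSesq n y x := by
  induction x using tensor_induction with
  | h0 => simp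
  | hadd a b ha hb => simp [ha, hb]
  | hsmul c a ha => simp [ha]
  | hpure v =>
    induction y using tensor_induction with
    | h0 => simp
    | hadd a b ha hb => simp [ha, hb]
    | hsmul c a ha => simp [ha]
    | hpure u => simp [tensorSesq_pureTensor]

open scoped ComplexOrder in
theorem posSemidef_prod {ι : Type*} [Fintype ι] {n : ℕ} (v : ι → Fin n → E) :
    (Matrix.of fun k l => ∏ i, inner ℂ (v k i) (v l i) : Matrix ι ι ℂ).PosSemidef := by
  classical
  suffices h : ∀ T : Finset (Fin n),
      (Matrix.of fun k l => ∏ i ∈ T, inner ℂ (v k i) (v l i) : Matrix ι ι ℂ).PosSemidef from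
    h Finset.univ
  intro T
  induction T using Finset.induction_on with
  | empty =>
    have e : (Matrix.of fun k l => ∏ i ∈ (∅ : Finset (Fin n)), inner ℂ (v k i) (v l i) :
        Matrix ι ι ℂ) = Matrix.gram ℂ (fun _ : ι => (1 : ℂ)) := by
      ext k l
      simp [Matrix.gram_apply]
    rw [e]
    exact Matrix.posSemidef_gram ℂ _
  | insert a T ha ih =>
    have e : (Matrix.of fun k l => ∏ i ∈ insert a T, inner ℂ (v k i) (v l i) : Matrix ι ι ℂ)
        = Matrix.hadamard (Matrix.gram ℂ (fun k : ι => v k a))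
          (Matrix.of fun k l => ∏ i ∈ T, inner ℂ (v k i) (v l i)) := by
      ext k l
      simp [Matrix.gram_apply, Finset.prod_insert ha]
    rw [e]
    exact (Matrix.posSemidef_gram ℂ _).hadamard ih

open scoped ComplexOrder in
theorem tensorSesq_nonneg {n : ℕ} (x : AlgTensorPower E n) :
    0 ≤ (tensorSesq n x x).re := by
  have hx : x ∈ Submodule.span ℂ (Set.range (pureTensor (E := E) n)) := by
    rw [span_pureTensor]; trivial
  obtain ⟨c, rfl⟩ := Finsupp.mem_span_range_iff_exists_finsupp.mp hx
  have h := (posSemidef_prod (fun k : c.support => (k : Fin n → E))).dotProduct_mulVec_nonneg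
    (fun k => c k)
  have h2 : tensorSesq n (c.sum fun i a => a • pureTensor n i) (c.sum fun i a => a • pureTensor n i)
      = star (fun k : c.support => c k) ⬝ᵥ Matrix.mulVec
        (Matrix.of fun k l : c.support => ∏ i, inner ℂ ((k : Fin n → E) i) ((l : Fin n → E) i))
        (fun k : c.support => c k) := by
    simp only [Finsupp.sum, ← Finset.sum_coe_sort c.support, map_sum, LinearMap.sum_apply,
      LinearMap.smul_apply, LinearMap.map_smulₛₗ, tensorSesq_pureTensor,
      dotProduct, Matrix.mulVec, Matrix.of_apply, smul_eq_mul, Finset.mul_sum, Pi.star_apply]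
    refine Finset.sum_congr rfl fun i _ => Finset.sum_congr rfl fun j _ => ?_
    simp only [RCLike.star_def, RingHom.id_apply]
    ring
  rw [h2]
  exact (Complex.le_def.mp h).1

/-- The semi-inner product `⟨x, y⟩` on the algebraic tensor power. -/
@[reducible]
def tensorCore (n : ℕ) : PreInnerProductSpace.Core ℂ (AlgTensorPower E n) where
  inner x y := tensorSesq n y x
  conj_inner_symm x y := tensorSesq_symm x y
  re_inner_nonneg x := tensorSesq_nonneg x
  add_left x y z := by simp
  smul_left x y r := by simp

instance (n : ℕ) : SeminormedAddCommGroup (AlgTensorPower E n) :=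
  @InnerProductSpace.Core.toSeminormedAddCommGroup ℂ _ _ _ _ (tensorCore n)

/-- The inner product on the algebraic tensor power, characterised by
`⟨u₁ ⊗ ⋯ ⊗ uₙ, v₁ ⊗ ⋯ ⊗ vₙ⟩ = ∏ᵢ ⟨uᵢ, vᵢ⟩`. -/
instance (n : ℕ) : InnerProductSpace ℂ (AlgTensorPower E n) :=
  InnerProductSpace.ofCore (tensorCore n)

theorem inner_pureTensor {n : ℕ} (u v : Fin n → E) :
    inner ℂ (pureTensor n u) (pureTensor n v) = ∏ i, inner ℂ (u i) (v i) :=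
  tensorSesq_pureTensor v u

theorem norm_pureTensor {n : ℕ} (u : Fin n → E) : ‖pureTensor n u‖ = ∏ i, ‖u i‖ := by
  have h : ‖pureTensor n u‖ ^ 2 = (∏ i, ‖u i‖) ^ 2 := by
    rw [← inner_self_eq_norm_sq (𝕜 := ℂ), inner_pureTensor, ← Finset.prod_pow]
    simp only [inner_self_eq_norm_sq_to_K]
    norm_cast
  exact (sq_eq_sq₀ (norm_nonneg _) (Finset.prod_nonneg fun _ _ => norm_nonneg _)).mp h

/-- The linear action of a permutation `σ` on the algebraic tensor power:
`u₁ ⊗ ⋯ ⊗ uₙ ↦ u_{σ⁻¹ 1} ⊗ ⋯ ⊗ u_{σ⁻¹ n}`. -/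
def algPerm {n : ℕ} (σ : Equiv.Perm (Fin n)) : AlgTensorPower E n →ₗ[ℂ] AlgTensorPower E n :=
  (PiTensorProduct.reindex ℂ (fun _ : Fin n => E) σ).toLinearMap

theorem algPerm_pureTensor {n : ℕ} (σ : Equiv.Perm (Fin n)) (u : Fin n → E) :
    algPerm σ (pureTensor n u) = pureTensor n fun i => u (σ.symm i) :=
  PiTensorProduct.reindex_tprod σ u

theorem inner_algPerm {n : ℕ} (σ : Equiv.Perm (Fin n)) (x y : AlgTensorPower E n) :
    inner ℂ (algPerm σ x) (algPerm σ y) = inner ℂ x y := by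
  induction x using tensor_induction with
  | h0 => simp
  | hadd a b ha hb => simp only [LinearMap.map_add, inner_add_left, ha, hb]
  | hsmul c a ha => simp only [LinearMap.map_smul, inner_smul_left, ha]
  | hpure v =>
    induction y using tensor_induction with
    | h0 => simp
    | hadd a b ha hb => simp only [LinearMap.map_add, inner_add_right, ha, hb]
    | hsmul c a ha => simp only [LinearMap.map_smul, inner_smul_right, ha]
    | hpure u =>
      simp only [algPerm_pureTensor, inner_pureTensor]
      exact σ.symm.prod_comp fun i => inner ℂ (v i) (u i)

/-- `algPerm σ` as a linear isometry. -/
def algPermIsometry {n : ℕ} (σ : Equiv.Perm (Fin n)) :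
    AlgTensorPower E n →ₗᵢ[ℂ] AlgTensorPower E n where
  toLinearMap := algPerm σ
  norm_map' x := by
    rw [@norm_eq_sqrt_re_inner ℂ, @norm_eq_sqrt_re_inner ℂ, inner_algPerm]

variable (E) in
/-- The Hilbert space tensor power `E^{⊗ n}`: the completion of the algebraic one. -/
abbrev HilbertTensorPower (n : ℕ) : Type _ := UniformSpace.Completion (AlgTensorPower E n)

/-- The action of a permutation on `E^{⊗ n}`, extended by continuity. -/
def perm {n : ℕ} (σ : Equiv.Perm (Fin n)) : HilbertTensorPower E n →L[ℂ] HilbertTensorPower E n :=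
  (algPermIsometry σ).toContinuousLinearMap.completion

/-- The symmetrizer `(n!)⁻¹ ∑_σ σ` on `E^{⊗ n}`. -/
def symmetrizer (n : ℕ) : HilbertTensorPower E n →L[ℂ] HilbertTensorPower E n :=
  (n.factorial : ℂ)⁻¹ • ∑ σ : Equiv.Perm (Fin n), perm σ

/-! ### The symmetric Fock space -/

variable (E) in
/-- The full Fock space `Γ(E) = ⨁ₙ E^{⊗ n}` (Hilbert space direct sum; `E^{⊗ 0} = ℂ`). -/
abbrev FullFock : Type _ := lp (fun n : ℕ => HilbertTensorPower E n) 2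

variable (E) in
/-- The symmetric Fock space `Γ_sym(E) ⊆ Γ(E)`: the range of the projection acting as the
symmetrizer on each `E^{⊗ n}`, i.e. the families of symmetric tensors. -/
def SymFock : Submodule ℂ (FullFock E) where
  carrier := {x | ∀ n, symmetrizer n (x n) = x n}
  zero_mem' n := by simp
  add_mem' hx hy n := by simp [hx n, hy n]
  smul_mem' c x hx n := by simp [hx n]

/-- The tensor `h^{⊗ n}`. -/
def tensorPow (h : E) (n : ℕ) : HilbertTensorPower E n :=
  ((pureTensor n fun _ => h : AlgTensorPower E n) : UniformSpace.Completion (AlgTensorPower E n))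

theorem norm_tensorPow (h : E) (n : ℕ) : ‖tensorPow h n‖ = ‖h‖ ^ n := by
  rw [tensorPow, UniformSpace.Completion.norm_coe, norm_pureTensor]
  simp

theorem perm_tensorPow (h : E) {n : ℕ} (σ : Equiv.Perm (Fin n)) :
    perm σ (tensorPow h n) = tensorPow h n := by
  have h1 : perm σ (tensorPow h n)
      = ((algPerm σ (pureTensor n fun _ => h) : AlgTensorPower E n) :
        UniformSpace.Completion (AlgTensorPower E n)) :=
    ContinuousLinearMap.completion_apply_coe _ _
  rw [h1, algPerm_pureTensor]
  rfl

theorem symmetrizer_tensorPow (h : E) (n : ℕ) :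
    symmetrizer n (tensorPow h n) = tensorPow h n := by
  have h0 : (n.factorial : ℂ) ≠ 0 := by exact_mod_cast n.factorial_ne_zero
  simp only [symmetrizer, smul_apply, sum_apply,
    perm_tensorPow, Finset.sum_const, Finset.card_univ, Fintype.card_perm, Fintype.card_fin]
  rw [← Nat.cast_smul_eq_nsmul ℂ, smul_smul, inv_mul_cancel₀ h0, one_smul]

theorem memlp_exponential (h : E) :
    Memℓp (fun n : ℕ => ((Real.sqrt n.factorial : ℂ)⁻¹ • tensorPow h n : HilbertTensorPower E n)) 2 := by
  apply memℓp_gen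
  have h1 := Real.summable_pow_div_factorial (‖h‖ ^ 2)
  refine h1.congr fun n => ?_
  have h2 : (0 : ℝ) ≤ n.factorial := Nat.cast_nonneg _
  rw [norm_smul, norm_tensorPow, norm_inv, Complex.norm_real, Real.norm_of_nonneg (Real.sqrt_nonneg _)]
  rw [ENNReal.toReal_ofNat, Real.rpow_ofNat, mul_pow, inv_pow, Real.sq_sqrt h2]
  ring

/-- The exponential vector `ε(h) = ∑ₙ (n!)^{-1/2} h^{⊗ n}`. -/
def exponential (h : E) : SymFock E :=
  ⟨⟨fun n => (Real.sqrt n.factorial : ℂ)⁻¹ • tensorPow h n, memlp_exponential h⟩, fun n => by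
    change symmetrizer n ((Real.sqrt n.factorial : ℂ)⁻¹ • tensorPow h n) = _
    rw [map_smul, symmetrizer_tensorPow]⟩

end Fock

/-! ### The one-particle space of `N` at scale `lam` -/

/-- The scaled Hilbert space `H_lam`: the space `H` with inner product `lam ^ 2 ⟨·, ·⟩_H`. -/
abbrev HScaled (N : GaussianCND) (lam : {r : ℝ // 0 < r}) : Type := Scaled lam (H N)

/-- The symmetric Fock space `Γ_sym(H_lam)`, a complex Hilbert space, built over the
complexification of the real Hilbert space `H_lam`. -/
abbrev FockSpace (N : GaussianCND) (lam : {r : ℝ // 0 < r}) : Type :=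
  SymFock (Complexification (HScaled N lam))

/-- The exponential vector `ε(φ_s) ∈ Γ_sym(H_lam)`. -/
def expPhi (N : GaussianCND) (lam : {r : ℝ // 0 < r}) (s : S) : FockSpace N lam :=
  exponential (Complexification.ofReal (toScaled lam (phi N s)))

/-- `P` is the measure `P_lam` on `S'` attached to `N`: the probability measure with
characteristic functional `E[exp (i X_s)] = exp (-lam ^ 2 N s / 2)`, where `X_s ω = ω s`. -/
structure IsWhiteNoiseMeasure (N : GaussianCND) (lam : {r : ℝ // 0 < r})
    (P : Measure TemperedDual) : Prop where
  isProbabilityMeasure : IsProbabilityMeasure P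
  charFun_eq (s : S) : ∫ ω, Complex.exp (Complex.I * (ω s : ℝ)) ∂P
    = Complex.exp (-((lam : ℝ) ^ 2 * N s / 2 : ℝ))

end

end WhiteNoise

section

open Filter Topology ProbabilityTheory

/-! The vectors `expPhi N lam s` and the normalised exponentials `hP.expL2 s` have the same Gram
matrix `exp (lam ^ 2 * cndKernel N s t)`: on the Fock side by summing the exponential series, on the
L² side by the Gaussian Laplace transform. Two total families with equal Gram matrices are matched
by exactly one unitary, so everything rests on totality. Throughout, quadratic homogeneity of `N`
makes `s ↦ φ_s` linear (`phi_add`).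

Totality in L² (`dense_span_expL2`): if a real `u` is orthogonal to every `exp X_s`, the measures
with densities `u⁺` and `u⁻` have equal moment generating functions along each `X_s`, hence equal
one-dimensional marginals, hence by linearity of `ω` equal finite-dimensional ones. They coincide
because the evaluations generate the Borel σ-algebra of `S'` (`borel_temperedDual_eq_comap`), which
uses separability of `S`.

Totality in Fock space (`dense_span_exponential`): if `x` is orthogonal to `ε(t d)` for all real
`t`, a power series in `t` vanishes identically, so each component `x n` is orthogonal to `d^{⊗ n}`;
polarization and symmetry give `x n = 0`.

The negative statement comes from pairing with the vacuum `ε(φ_0)`, where the two Gram entries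
differ. -/

/-! ### Unitaries from equal Gram matrices -/

theorem exists_linearIsometryEquiv_of_inner_eq {ι E F : Type*}
    [NormedAddCommGroup E] [InnerProductSpace ℂ E] [CompleteSpace E]
    [NormedAddCommGroup F] [InnerProductSpace ℂ F] [CompleteSpace F] (e : ι → E) (f : ι → F)
    (he : Dense (Submodule.span ℂ (Set.range e) : Set E))
    (hf : Dense (Submodule.span ℂ (Set.range f) : Set F))
    (h : ∀ i j, inner ℂ (e i) (e j) = inner ℂ (f i) (f j)) :
    ∃ W : E ≃ₗᵢ[ℂ] F, ∀ i, W (e i) = f i := by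
  have he' : DenseRange (Finsupp.linearCombination ℂ e) := by
    rwa [DenseRange, ← LinearMap.coe_range, Finsupp.range_linearCombination]
  have hf' : DenseRange (Finsupp.linearCombination ℂ f) := by
    rwa [DenseRange, ← LinearMap.coe_range, Finsupp.range_linearCombination]
  -- The norm of a linear combination depends only on the coefficients and the Gram matrix; this
  -- also handles linear relations among the vectors.
  have hn : ∀ c : ι →₀ ℂ, ‖Finsupp.linearCombination ℂ f (LinearEquiv.refl ℂ (ι →₀ ℂ) c)‖
      = ‖Finsupp.linearCombination ℂ e c‖ := by
    intro c
    rw [@norm_eq_sqrt_re_inner ℂ, @norm_eq_sqrt_re_inner ℂ]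
    simp only [LinearEquiv.refl_apply, Finsupp.linearCombination_apply, Finsupp.sum, sum_inner,
      inner_sum, inner_smul_left, inner_smul_right, h]
  refine ⟨(LinearEquiv.refl ℂ (ι →₀ ℂ)).extendOfIsometry _ _ he' hf' hn, fun i => ?_⟩
  have h1 := LinearEquiv.extendOfIsometry_eq (LinearEquiv.refl ℂ (ι →₀ ℂ)) _ _ he' hf' hn
    (Finsupp.single i 1)
  simpa using h1

theorem dense_span_of_forall_inner_eq_zero {E : Type*} [NormedAddCommGroup E]
    [InnerProductSpace ℂ E] [CompleteSpace E] {A : Set E}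
    (h : ∀ x : E, (∀ a ∈ A, inner ℂ a x = 0) → x = 0) :
    Dense (Submodule.span ℂ A : Set E) := by
  rw [Submodule.dense_iff_topologicalClosure_eq_top, Submodule.topologicalClosure_eq_top_iff,
    Submodule.eq_bot_iff]
  exact fun x hx => h x fun a ha =>
    (Submodule.mem_orthogonal _ x).mp hx a (Submodule.subset_span ha)

/-! ### Linearity of the feature map -/

namespace WhiteNoise

variable (N : GaussianCND)

theorem norm_phi_sub_sq (s t : S) : ‖phi N s - phi N t‖ ^ 2 = N (s - t) := by
  rw [@norm_sub_sq_real, ← real_inner_self_eq_norm_sq, ← real_inner_self_eq_norm_sq, inner_phi,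
    inner_phi, inner_phi]
  simp only [cndKernel, sub_self, GaussianCND.map_zero]
  ring

theorem inner_phi_self (s : S) : inner ℝ (phi N s) (phi N s) = N s := by
  rw [inner_phi, cndKernel, sub_self, GaussianCND.map_zero]
  ring

theorem norm_phi_sq (s : S) : ‖phi N s‖ ^ 2 = N s := by
  rw [← real_inner_self_eq_norm_sq, inner_phi_self]

theorem GaussianCND.nonneg (s : S) : 0 ≤ N s := norm_phi_sq N s ▸ sq_nonneg _

theorem phi_smul (a : ℝ) (s : S) : phi N (a • s) = a • phi N s := by
  rw [← sub_eq_zero, ← norm_eq_zero, ← sq_eq_zero_iff, @norm_sub_sq_real, norm_smul, mul_pow,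
    norm_phi_sq, norm_phi_sq, inner_smul_right, inner_phi, cndKernel]
  have h : a • s - s = (a - 1) • s := by module
  rw [h, N.map_smul', N.map_smul', Real.norm_eq_abs, sq_abs]
  ring

/-- Equality in the parallelogram law. For the midpoint `m`, both `‖φ_m - φ_s‖²` and `‖φ_m - φ_t‖²`
equal `N (s - t) / 4`, while `‖φ_t - φ_s‖² = N (s - t)`; this leaves no room for `2 φ_m - (φ_s +
φ_t)`. -/
theorem phi_add (s t : S) : phi N (s + t) = phi N s + phi N t := by
  have h : phi N (s + t) = (2 : ℝ) • phi N ((1 / 2 : ℝ) • (s + t)) := by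
    rw [← phi_smul, smul_smul]; norm_num
  set m := (1 / 2 : ℝ) • (s + t) with hm
  have e1 : m - s = (-1 / 2 : ℝ) • (s - t) := by rw [hm]; module
  have e2 : m - t = (1 / 2 : ℝ) • (s - t) := by rw [hm]; module
  have h1 := norm_phi_sub_sq N m s
  have h2 := norm_phi_sub_sq N m t
  have h3 := norm_phi_sub_sq N t s
  rw [e1, N.map_smul'] at h1
  rw [e2, N.map_smul'] at h2
  rw [N.map_sub_comm] at h3
  have h4 := parallelogram_law_with_norm ℝ (phi N m - phi N s) (phi N m - phi N t)
  have e3 : phi N m - phi N s - (phi N m - phi N t) = phi N t - phi N s := by abel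
  have e4 : phi N m - phi N s + (phi N m - phi N t)
      = (2 : ℝ) • phi N m - (phi N s + phi N t) := by module
  rw [e3, e4] at h4
  rw [h, ← sub_eq_zero, ← norm_eq_zero, ← mul_self_eq_zero]
  linarith

/-- The map `s ↦ φ_s` is linear. -/
noncomputable def phiLinear : S →ₗ[ℝ] H N where
  toFun := phi N
  map_add' := phi_add N
  map_smul' := phi_smul N

/-- By linearity the range is already the span of the kernel functions, so no linear combinations
are needed. -/
theorem denseRange_phi : DenseRange (phi N) := by
  have h1 : Dense (LinearMap.range (phiLinear N) : Set (H N)) := by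
    rw [Submodule.dense_iff_topologicalClosure_eq_top, eq_top_iff, ← RKHS.kerFun_dense (H N)]
    refine Submodule.topologicalClosure_mono (Submodule.span_le.mpr ?_)
    rintro _ ⟨s, v, rfl⟩
    refine ⟨v • s, ?_⟩
    rw [map_smul]
    change v • RKHS.kerFun (H N) s 1 = _
    rw [← map_smul, smul_eq_mul, mul_one]
  exact h1

theorem GaussianCND.map_add_eq (s t : S) : N (s + t) = N s + N t + 2 * cndKernel N s t := by
  rw [← norm_phi_sq, phi_add, @norm_add_sq_real, norm_phi_sq, norm_phi_sq, inner_phi]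
  ring

end WhiteNoise

/-! ### Second countability of the Schwartz space -/

/-- The compactified line is a circle. This makes `C(OnePoint ℝ, ℝ)`, into which the Schwartz
seminorms embed, second countable. -/
instance OnePoint.secondCountableTopology_real : SecondCountableTopology (OnePoint ℝ) :=
  (onePointEquivSphereOfFinrankEq (ι := Fin 2) (V := ℝ) (by simp)).secondCountableTopology

theorem Seminorm.secondCountableTopology_of_norm_eq {V W : Type*} [AddCommGroup V] [Module ℝ V]
    [SeminormedAddCommGroup W] [NormedSpace ℝ W] [SecondCountableTopology W] (T : V →ₗ[ℝ] W)
    (p : Seminorm ℝ V) (h : ∀ x, ‖T x‖ = p x) :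
    @SecondCountableTopology V
      p.toSeminormedAddCommGroup.toUniformSpace.toTopologicalSpace := by
  let _ := p.toSeminormedAddCommGroup
  have hT : Isometry T := AddMonoidHomClass.isometry_of_norm T h
  exact hT.isUniformInducing.isInducing.secondCountableTopology

namespace SchwartzMap

theorem tendsto_pow_mul_iteratedDeriv (k n : ℕ) (f : 𝓢(ℝ, ℝ)) :
    Tendsto (fun x => x ^ k * iteratedDeriv n f x) (cocompact ℝ) (𝓝 0) := by
  -- One spare power: the seminorm of index `k + 1` bounds the function by a constant times `1 /
  -- |x|`.
  have h1 : Tendsto (fun x : ℝ => SchwartzMap.seminorm ℝ (k + 1) n f * ‖x‖⁻¹) (cocompact ℝ)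
      (𝓝 0) := by
    simpa using (tendsto_inv_atTop_zero.comp (tendsto_norm_cocompact_atTop (E := ℝ))).const_mul
      (SchwartzMap.seminorm ℝ (k + 1) n f)
  refine squeeze_zero_norm' ?_ h1
  filter_upwards [(tendsto_norm_cocompact_atTop (E := ℝ)).eventually_gt_atTop 0] with x hx
  rw [← div_eq_mul_inv, le_div_iff₀ hx, norm_mul, norm_pow]
  have h2 := SchwartzMap.le_seminorm ℝ (k + 1) n f x
  rw [norm_iteratedFDeriv_eq_norm_iteratedDeriv] at h2
  calc _ = ‖x‖ ^ (k + 1) * ‖iteratedDeriv n f x‖ := by ring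
    _ ≤ _ := h2

/-- The function `x ↦ x ^ k f⁽ⁿ⁾(x)` of a Schwartz function `f`, extended by `0` at infinity. -/
noncomputable def powMulIteratedDeriv (k n : ℕ) : 𝓢(ℝ, ℝ) →ₗ[ℝ] C(OnePoint ℝ, ℝ) where
  toFun f := OnePoint.continuousMapMk
    ⟨fun x => x ^ k * iteratedDeriv n f x, (continuous_id.pow k).mul
      ((f.smooth ⊤).continuous_iteratedDeriv n (by exact_mod_cast le_top))⟩ 0
    (by simpa using tendsto_pow_mul_iteratedDeriv k n f)
  map_add' f g := by
    ext x
    induction x using OnePoint.rec with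
    | infty => simp [OnePoint.continuousMapMk]
    | coe x =>
      have h := iteratedDeriv_add (n := n) (x := x) ((f.smooth n).contDiffAt)
        ((g.smooth n).contDiffAt)
      simp [OnePoint.continuousMapMk, h, mul_add]
  map_smul' c f := by
    ext x
    induction x using OnePoint.rec with
    | infty => simp [OnePoint.continuousMapMk]
    | coe x =>
      simp [OnePoint.continuousMapMk, mul_left_comm]

theorem norm_powMulIteratedDeriv (k n : ℕ) (f : 𝓢(ℝ, ℝ)) :
    ‖powMulIteratedDeriv k n f‖ = SchwartzMap.seminorm ℝ k n f := by
  apply le_antisymm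
  · rw [ContinuousMap.norm_le _ (apply_nonneg _ _)]
    intro x
    induction x using OnePoint.rec with
    | infty => simp [powMulIteratedDeriv, OnePoint.continuousMapMk]
    | coe x =>
      have h := SchwartzMap.le_seminorm ℝ k n f x
      rw [norm_iteratedFDeriv_eq_norm_iteratedDeriv, ← norm_pow, ← norm_mul] at h
      exact h
  · refine SchwartzMap.seminorm_le_bound ℝ k n f (norm_nonneg _) fun x => ?_
    rw [norm_iteratedFDeriv_eq_norm_iteratedDeriv, ← norm_pow, ← norm_mul]
    exact (powMulIteratedDeriv k n f).norm_coe_le_norm (x : OnePoint ℝ)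

/-- The Schwartz topology is the infimum of countably many seminorm topologies, each induced by
`powMulIteratedDeriv` from a separable sup-norm space. -/
instance secondCountableTopology_real : SecondCountableTopology 𝓢(ℝ, ℝ) := by
  rw [(SeminormFamily.withSeminorms_iff_topologicalSpace_eq_iInf _).mp
    (schwartz_withSeminorms ℝ ℝ ℝ)]
  exact TopologicalSpace.secondCountableTopology_iInf fun i =>
    Seminorm.secondCountableTopology_of_norm_eq (powMulIteratedDeriv i.1 i.2) _
      fun f => norm_powMulIteratedDeriv i.1 i.2 f

end SchwartzMap

/-! ### The Borel σ-algebra of the space of tempered distributions -/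

namespace WhiteNoise

theorem measurable_eval (s : S) : Measurable fun ω : TemperedDual => ω s :=
  (WeakDual.eval_continuous s).measurable

/-- On the polar of a neighbourhood of `0`, the weak-* topology is induced by the evaluations at
the points of a dense set. -/
theorem isInducing_eval_polar {D : Set S} (hD : Dense D) {V : Set S} (hV : V ∈ 𝓝 (0 : S)) :
    IsInducing fun (ω : {ω : TemperedDual | ∀ s ∈ V, |ω s| ≤ 1}) (d : D) =>
      (ω : TemperedDual) (d : S) := by
  refine ⟨le_antisymm ?_ ?_⟩
  · rw [← continuous_iff_le_induced]
    exact continuous_pi fun d => (WeakDual.eval_continuous _).comp continuous_subtype_val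
  let K := {ω : TemperedDual | ∀ s ∈ V, |ω s| ≤ 1}
  let τ : TopologicalSpace K := TopologicalSpace.induced
    (fun (ω : K) (d : D) => (ω : TemperedDual) (d : S)) inferInstance
  change τ ≤ TopologicalSpace.induced Subtype.val _
  rw [← continuous_iff_le_induced]
  refine WeakDual.continuous_of_continuous_eval fun s => ?_
  -- The polar is equicontinuous, so evaluation at any `s` is a uniform limit on it of evaluations
  -- at points of `D`.
  refine continuous_of_uniform_approx_of_continuous fun u hu => ?_
  obtain ⟨ε, hε, hεu⟩ := Metric.mem_uniformity_dist.mp hu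
  -- With `s - t` in `(ε / 2) V`, every `ω` in the polar satisfies `|ω s - ω t| ≤ ε / 2`, strictly
  -- below `ε`.
  have h1 : {t : S | (2 / ε) • (s - t) ∈ V} ∈ 𝓝 s := by
    have h2 : Tendsto (fun t : S => (2 / ε) • (s - t)) (𝓝 s) (𝓝 ((2 / ε) • (s - s))) :=
      (((continuous_const (y := s)).sub continuous_id).const_smul (2 / ε)).tendsto s
    rw [sub_self, smul_zero] at h2
    exact h2 hV
  obtain ⟨d, hd, hdD⟩ := mem_closure_iff_nhds.mp (hD s) _ h1
  refine ⟨fun ω => (ω : TemperedDual) d, ?_, fun ω => hεu ?_⟩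
  · have h3 : Continuous[τ, _] fun (ω : K) (d : D) => (ω : TemperedDual) (d : S) :=
      continuous_induced_dom
    exact continuous_pi_iff.mp h3 ⟨d, hdD⟩
  · have h3 := ω.2 _ hd
    rw [map_smul, map_sub, smul_eq_mul, abs_mul, abs_of_pos (by positivity)] at h3
    rw [Real.dist_eq]
    calc |(ω : TemperedDual) s - (ω : TemperedDual) d|
        = ε / 2 * (2 / ε * |(ω : TemperedDual) s - (ω : TemperedDual) d|) := by field_simp
      _ ≤ ε / 2 * 1 := by gcongr
      _ < ε := by linarith

/-- For countable `D` this writes a polar as a countable intersection, hence as a set measurable for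
the evaluations. -/
theorem mem_polar_iff_of_dense {D : Set S} (hD : Dense D) {V : Set S} (hV : IsOpen V)
    (ω : TemperedDual) : (∀ s ∈ V, |ω s| ≤ 1) ↔ ∀ s ∈ D ∩ V, |ω s| ≤ 1 := by
  refine ⟨fun h s hs => h s hs.2, fun h s hs => ?_⟩
  have hc : IsClosed {s : S | |ω s| ≤ 1} :=
    isClosed_le (map_continuous ω).abs continuous_const
  have h1 : closure (V ∩ D) ⊆ {s : S | |ω s| ≤ 1} :=
    closure_minimal (fun t ht => h t ⟨ht.2, ht.1⟩) hc
  exact h1 (hD.open_subset_closure_inter hV hs)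

/-- The Borel `σ`-algebra of `S'` is generated by the evaluations `X_s`. -/
theorem borel_temperedDual_eq_comap :
    instMeasurableSpaceTemperedDual
      = MeasurableSpace.comap (fun (ω : TemperedDual) (s : S) => ω s) MeasurableSpace.pi := by
  apply le_antisymm
  swap
  · exact (measurable_pi_lambda _ measurable_eval).comap_le
  obtain ⟨D, hDc, hDd⟩ := TopologicalSpace.exists_countable_dense S
  have := hDc.to_subtype
  obtain ⟨V, hV, hVb⟩ := (nhds_basis_opens (0 : S)).exists_antitone_subbasis
  -- Polars of a countable neighbourhood basis of `0` cover `S'` by continuity of each `ω`; it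
  -- suffices to treat an open set inside each of them.
  let K : ℕ → Set TemperedDual := fun n => {ω | ∀ s ∈ V n, |ω s| ≤ 1}
  have hK : ∀ ω : TemperedDual, ∃ n, ω ∈ K n := by
    intro ω
    have h1 : {s : S | |ω s| ≤ 1} ∈ 𝓝 (0 : S) := by
      have h2 : Tendsto (fun s : S => |ω s|) (𝓝 0) (𝓝 |ω 0|) :=
        (map_continuous ω).abs.tendsto 0
      rw [map_zero, abs_zero] at h2
      exact h2.eventually_le_const one_pos
    obtain ⟨n, hn⟩ := hVb.mem_iff.mp h1
    exact ⟨n, hn⟩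
  refine MeasurableSpace.generateFrom_le fun U hU => ?_
  let m : MeasurableSpace TemperedDual :=
    MeasurableSpace.comap (fun (ω : TemperedDual) (s : S) => ω s) MeasurableSpace.pi
  change MeasurableSet[m] U
  have hev : ∀ s : S, Measurable[m] fun ω : TemperedDual => ω s := fun s =>
    (measurable_pi_apply s).comp (comap_measurable _)
  have hKm : ∀ n, MeasurableSet[m] (K n) := by
    intro n
    have h1 : K n = ⋂ s ∈ D ∩ V n, {ω : TemperedDual | |ω s| ≤ 1} := by
      ext ω
      simp only [Set.mem_iInter]
      exact mem_polar_iff_of_dense hDd (hV n).2 ω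
    rw [h1]
    refine MeasurableSet.biInter (hDc.mono Set.inter_subset_left) fun s _ => ?_
    exact measurableSet_le (hev s).abs measurable_const
  have hU' : U = ⋃ n, K n ∩ U := by
    rw [← Set.iUnion_inter, Set.iUnion_eq_univ_iff.mpr hK, Set.univ_inter]
  rw [hU']
  refine MeasurableSet.iUnion fun n => ?_
  -- Inside `K n`, the set `U` is the preimage of an open `O ⊆ ℝ^D`. As `D` is countable, `O` is
  -- measurable for the product σ-algebra.
  obtain ⟨O, hO, hOU⟩ := (isInducing_eval_polar hDd ((hV n).2.mem_nhds (hV n).1)).isOpen_iff.mp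
    (IsOpen.preimage continuous_subtype_val (show IsOpen U from hU))
  have h2 : K n ∩ U = K n ∩ (fun (ω : TemperedDual) (d : D) => ω (d : S)) ⁻¹' O := by
    ext ω
    refine and_congr_right fun hω => ?_
    exact (Set.ext_iff.mp hOU ⟨ω, hω⟩).symm
  rw [h2]
  exact (hKm n).inter ((measurable_pi_lambda _ fun d : D => hev d) hO.measurableSet)

end WhiteNoise

/-! ### Uniqueness of measures from Laplace transforms and marginals -/

/-- Finite laws with equal, everywhere finite moment generating functions agree. -/
theorem MeasureTheory.Measure.map_eq_of_mgf_eq {Ω Ω' : Type*} {mΩ : MeasurableSpace Ω}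
    {mΩ' : MeasurableSpace Ω'} {μ : Measure Ω} {ν : Measure Ω'} [IsFiniteMeasure μ]
    [IsFiniteMeasure ν] {X : Ω → ℝ} {Y : Ω' → ℝ} (hX : AEMeasurable X μ) (hY : AEMeasurable Y ν)
    (hi : ∀ t, Integrable (fun ω => Real.exp (t * X ω)) μ) (h : mgf X μ = mgf Y ν) :
    μ.map X = ν.map Y := by
  refine Measure.ext_of_complexMGF_eq hX hY (funext fun z => ?_)
  have h0 : μ.real Set.univ = ν.real Set.univ := by
    simpa [mgf] using congrFun h 0
  have h1 : μ = 0 ↔ ν = 0 := by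
    rw [← Measure.measure_univ_eq_zero, ← Measure.measure_univ_eq_zero, ← measureReal_eq_zero_iff,
      ← measureReal_eq_zero_iff, h0]
  refine eqOn_complexMGF_of_mgf' h h1 ?_
  -- Finiteness for every real `t` makes the strip of analyticity the whole plane, so equality on
  -- the real axis extends to every `z`.
  have h2 : integrableExpSet X μ = Set.univ := Set.eq_univ_of_forall hi
  simp [h2]

namespace WhiteNoise

/-- A finite measure on `S'` is determined by its one-dimensional marginals. -/
theorem measure_ext_of_map_eval {μ ν : Measure TemperedDual} [IsFiniteMeasure μ]
    [IsFiniteMeasure ν]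
    (h : ∀ s : S, μ.map (fun ω => ω s) = ν.map (fun ω => ω s)) : μ = ν := by
  let r : TemperedDual → S → ℝ := fun ω s => ω s
  have hr : Measurable r := measurable_pi_lambda _ measurable_eval
  have hI : ∀ I : Finset S, (μ.map r).map I.restrict = (ν.map r).map I.restrict := by
    intro I
    have hrI : Measurable (fun (ω : TemperedDual) (s : I) => ω (s : S)) :=
      measurable_pi_lambda _ fun s => measurable_eval _
    rw [Measure.map_map (Finset.measurable_restrict I) hr,
      Measure.map_map (Finset.measurable_restrict I) hr]
    change μ.map (fun (ω : TemperedDual) (s : I) => ω (s : S))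
      = ν.map (fun (ω : TemperedDual) (s : I) => ω (s : S))
    refine Measure.ext_of_charFunDual (funext fun L => ?_)
    rw [charFunDual_apply, charFunDual_apply, integral_map hrI.aemeasurable
      (by fun_prop), integral_map hrI.aemeasurable (by fun_prop)]
    classical
    -- The Cramér–Wold device: a functional `L` of the coordinates `ω s` is evaluation at one test
    -- function, as `ω` is linear.
    let t : S := ∑ s : I, L (Pi.single s 1) • (s : S)
    have ht : ∀ ω : TemperedDual, L (fun s : I => ω (s : S)) = ω t := by
      intro ω
      rw [map_sum]
      conv_lhs => rw [pi_eq_sum_univ' (fun s : I => ω (s : S)), map_sum]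
      refine Finset.sum_congr rfl fun s _ => ?_
      rw [map_smul, map_smul, smul_eq_mul, smul_eq_mul, mul_comm]
    simp only [ht]
    have h1 : ∀ ρ : Measure TemperedDual, ∫ ω, Complex.exp ((ω t : ℝ) * Complex.I) ∂ρ
        = ∫ x, Complex.exp ((x : ℝ) * Complex.I) ∂(ρ.map (fun ω => ω t)) := fun ρ => by
      rw [integral_map (measurable_eval t).aemeasurable (by fun_prop)]
    rw [h1, h1, h]
  have hμν : μ.map r = ν.map r :=
    IsProjectiveLimit.unique (P := fun I : Finset S => (μ.map r).map I.restrict)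
      (fun I => rfl) (fun I => (hI I).symm)
  ext A hA
  obtain ⟨B, hB, rfl⟩ : ∃ B, MeasurableSet B ∧ r ⁻¹' B = A := by
    rw [borel_temperedDual_eq_comap] at hA
    exact hA
  rw [← Measure.map_apply hr hB, hμν, Measure.map_apply hr hB]

/-! ### Gaussian marginals and totality of the exponentials in L² -/

variable {N : GaussianCND} {lam : {r : ℝ // 0 < r}} {P : Measure TemperedDual}

/-- The characteristic function of `X_s` at `t` is the characteristic functional at `t • s`, where
homogeneity of `N` produces the factor `t ^ 2`. -/
theorem IsWhiteNoiseMeasure.map_eval (hP : IsWhiteNoiseMeasure N lam P) (s : S) :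
    P.map (fun ω => ω s) = gaussianReal 0 (((lam : ℝ) ^ 2 * N s).toNNReal) := by
  have := hP.isProbabilityMeasure
  have h0 : 0 ≤ (lam : ℝ) ^ 2 * N s := mul_nonneg (sq_nonneg _) (N.nonneg s)
  have : IsProbabilityMeasure (P.map (fun ω => ω s)) :=
    Measure.isProbabilityMeasure_map (measurable_eval s).aemeasurable
  refine Measure.ext_of_charFun (funext fun t => ?_)
  rw [charFun_gaussianReal, charFun_apply_real, integral_map (measurable_eval s).aemeasurable
    (by fun_prop), Real.coe_toNNReal _ h0]
  have h1 := hP.charFun_eq (t • s)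
  rw [N.map_smul'] at h1
  simp only [map_smul, smul_eq_mul] at h1
  convert h1 using 2
  · ext ω; push_cast; ring_nf
  · push_cast; ring_nf

theorem IsWhiteNoiseMeasure.integrable_exp (hP : IsWhiteNoiseMeasure N lam P) (s : S) :
    Integrable (fun ω : TemperedDual => Real.exp (ω s)) P := by
  have h := integrable_exp_mul_gaussianReal (μ := 0) (v := ((lam : ℝ) ^ 2 * N s).toNNReal) 1
  rw [← hP.map_eval, integrable_map_measure (by fun_prop) (measurable_eval s).aemeasurable] at h
  simpa [Function.comp_def] using h

theorem IsWhiteNoiseMeasure.integral_exp (hP : IsWhiteNoiseMeasure N lam P) (s : S) :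
    ∫ ω, Real.exp (ω s) ∂P = Real.exp ((lam : ℝ) ^ 2 * N s / 2) := by
  have h0 : 0 ≤ (lam : ℝ) ^ 2 * N s := mul_nonneg (sq_nonneg _) (N.nonneg s)
  have h := mgf_gaussianReal (hP.map_eval s) 1
  simpa [mgf, Real.coe_toNNReal _ h0] using h

theorem IsWhiteNoiseMeasure.memLp_exp (hP : IsWhiteNoiseMeasure N lam P) (s : S) (c : ℝ) :
    MemLp (fun ω : TemperedDual => Complex.exp ((ω s - c : ℝ) : ℂ)) 2 P := by
  have hm : Measurable fun ω : TemperedDual => Complex.exp ((ω s - c : ℝ) : ℂ) :=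
    Complex.measurable_exp.comp (Complex.measurable_ofReal.comp
      ((measurable_eval s).sub_const c))
  rw [memLp_two_iff_integrable_sq_norm hm.aestronglyMeasurable]
  have h := (hP.integrable_exp ((2 : ℝ) • s)).mul_const (Real.exp (-(2 * c)))
  refine h.congr (ae_of_all _ fun ω => ?_)
  simp only [map_smul, smul_eq_mul]
  rw [← Complex.ofReal_exp, Complex.norm_real, Real.norm_of_nonneg (Real.exp_nonneg _),
    ← Real.exp_add, ← Real.exp_nat_mul]
  congr 1
  push_cast
  ring

/-- A function with vanishing integrals against all `exp X_s` vanishes almost everywhere. -/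
theorem ae_eq_zero_of_forall_integral_exp_mul_eq_zero {u : TemperedDual → ℝ}
    (hu : Measurable u)
    (hi : ∀ s : S, Integrable (fun ω : TemperedDual => Real.exp (ω s) * u ω) P)
    (h : ∀ s : S, ∫ ω : TemperedDual, Real.exp (ω s) * u ω ∂P = 0) : u =ᵐ[P] 0 := by
  have hu1 : Integrable u P := by simpa using hi 0
  -- Since `ENNReal.ofReal` truncates negative values to `0`, the densities obtained from `u` and
  -- `-u` are `u⁺` and `u⁻`.
  have key : ∀ v : TemperedDual → ℝ, Measurable v →
      (∀ s : S, Integrable (fun ω : TemperedDual => Real.exp (ω s) * v ω) P) → ∀ s : S,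
      Integrable (fun ω : TemperedDual => Real.exp (ω s))
        (P.withDensity fun ω => ENNReal.ofReal (v ω)) ∧
      ∫ ω : TemperedDual, Real.exp (ω s) ∂(P.withDensity fun ω => ENNReal.ofReal (v ω))
        = ∫ ω : TemperedDual, max (Real.exp (ω s) * v ω) 0 ∂P := by
    intro v hv hvi s
    have e : ∀ ω : TemperedDual, (ENNReal.ofReal (v ω)).toReal • Real.exp (ω s)
        = max (Real.exp (ω s) * v ω) 0 := fun ω => by
      rw [ENNReal.toReal_ofReal', smul_eq_mul, mul_comm, mul_max_of_nonneg _ _ (Real.exp_nonneg _),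
        mul_zero]
    constructor
    · rw [integrable_withDensity_iff_integrable_smul' hv.ennreal_ofReal (by simp)]
      simp only [e]
      exact (hvi s).pos_part
    · rw [integral_withDensity_eq_integral_toReal_smul hv.ennreal_ofReal (by simp)]
      simp only [e]
  have := isFiniteMeasure_withDensity_ofReal hu1.2
  have := isFiniteMeasure_withDensity_ofReal hu1.neg.2
  have hi' : ∀ s : S, Integrable (fun ω : TemperedDual => Real.exp (ω s) * (-u) ω) P := fun s => by
    simpa using (hi s).neg
  have hμν : (P.withDensity fun ω => ENNReal.ofReal (u ω))
      = P.withDensity fun ω => ENNReal.ofReal ((-u) ω) := by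
    refine measure_ext_of_map_eval fun s => ?_
    refine Measure.map_eq_of_mgf_eq (measurable_eval s).aemeasurable
      (measurable_eval s).aemeasurable (fun t => ?_) (funext fun t => ?_)
    · simpa only [map_smul, smul_eq_mul] using (key u hu hi (t • s)).1
    · have h1 := (key u hu hi (t • s)).2
      have h2 := (key (-u) hu.neg hi' (t • s)).2
      have h3 : ∀ ρ : Measure TemperedDual, mgf (fun ω => ω s) ρ t
          = ∫ ω : TemperedDual, Real.exp (ω (t • s)) ∂ρ := fun ρ => by
        simp only [mgf, map_smul, smul_eq_mul]
      rw [h3, h3, h1, h2]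
      -- The difference of the two transforms is the integral of `exp X_{ts} * u`, which vanishes by
      -- hypothesis.
      rw [← sub_eq_zero, ← integral_sub (hi _).pos_part (hi' _).pos_part]
      refine Eq.trans ?_ (h (t • s))
      refine integral_congr_ae (ae_of_all _ fun ω => ?_)
      simp only [Pi.neg_apply, mul_neg]
      rw [max_zero_sub_max_neg_zero_eq_self]
  rw [withDensity_eq_iff hu.ennreal_ofReal.aemeasurable hu.neg.ennreal_ofReal.aemeasurable
    hu1.lintegral_lt_top.ne] at hμν
  filter_upwards [hμν] with ω hω
  have h3 := congrArg ENNReal.toReal hω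
  rw [ENNReal.toReal_ofReal', ENNReal.toReal_ofReal'] at h3
  have h4 := max_zero_sub_max_neg_zero_eq_self (u ω)
  rw [← h4]
  exact sub_eq_zero.mpr h3

/-- The normalised exponential `exp (X_s - λ ^ 2 N s / 2)` as an element of `L²(P_λ)`. -/
noncomputable def IsWhiteNoiseMeasure.expL2 (hP : IsWhiteNoiseMeasure N lam P) (s : S) :
    Lp ℂ 2 P :=
  (hP.memLp_exp s ((lam : ℝ) ^ 2 * N s / 2)).toLp

theorem IsWhiteNoiseMeasure.coeFn_expL2 (hP : IsWhiteNoiseMeasure N lam P) (s : S) :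
    hP.expL2 s =ᵐ[P] fun ω => Complex.exp ((ω s - (lam : ℝ) ^ 2 * N s / 2 : ℝ) : ℂ) :=
  MemLp.coeFn_toLp _

/-- The product of two exponentials is the exponential of `X_{s+t}`; in `N (s + t) = N s + N t + 2 *
cndKernel N s t` the normalisations cancel all but the cross term. -/
theorem IsWhiteNoiseMeasure.inner_expL2 (hP : IsWhiteNoiseMeasure N lam P) (s t : S) :
    inner ℂ (hP.expL2 s) (hP.expL2 t) = Complex.exp (((lam : ℝ) ^ 2 * cndKernel N s t : ℝ) : ℂ) := by
  rw [L2.inner_def]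
  have h1 : ∀ᵐ ω ∂P, inner ℂ (hP.expL2 s ω) (hP.expL2 t ω)
      = ((Real.exp (ω (s + t)) * Real.exp (-((lam : ℝ) ^ 2 * (N s + N t) / 2)) : ℝ) : ℂ) := by
    filter_upwards [hP.coeFn_expL2 s, hP.coeFn_expL2 t] with ω hs ht
    rw [hs, ht, ← Complex.ofReal_exp, ← Complex.ofReal_exp, ← Real.exp_add]
    simp only [RCLike.inner_apply, Complex.conj_ofReal]
    rw [← Complex.ofReal_mul, ← Real.exp_add, map_add]
    congr 2
    ring
  rw [integral_congr_ae h1, integral_complex_ofReal, integral_mul_const, hP.integral_exp, ← Real.exp_add,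
    N.map_add_eq, Complex.ofReal_exp]
  congr 2
  ring

theorem IsWhiteNoiseMeasure.dense_span_expL2 (hP : IsWhiteNoiseMeasure N lam P) :
    Dense (Submodule.span ℂ (Set.range hP.expL2) : Set (Lp ℂ 2 P)) := by
  have := hP.isProbabilityMeasure
  refine dense_span_of_forall_inner_eq_zero fun g hg => ?_
  have hi0 : ∀ s : S, Integrable (fun ω : TemperedDual => (Real.exp (ω s) : ℂ) * g ω) P := by
    intro s
    have h1 := hP.memLp_exp s 0
    have h2 := MemLp.integrable_mul h1 (Lp.memLp g)
    simpa [Pi.mul_def] using h2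
  have h0 : ∀ s : S, ∫ ω, (Real.exp (ω s) : ℂ) * g ω ∂P = 0 := by
    intro s
    have h1 := hg _ ⟨s, rfl⟩
    rw [L2.inner_def] at h1
    have h2 : ∀ᵐ ω ∂P, inner ℂ (hP.expL2 s ω) (g ω)
        = (Real.exp (-((lam : ℝ) ^ 2 * N s / 2)) : ℂ) * ((Real.exp (ω s) : ℂ) * g ω) := by
      filter_upwards [hP.coeFn_expL2 s] with ω hs
      rw [hs, ← Complex.ofReal_exp]
      simp only [RCLike.inner_apply, Complex.conj_ofReal]
      rw [sub_eq_add_neg, Real.exp_add]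
      push_cast
      ring
    rw [integral_congr_ae h2, integral_const_mul] at h1
    exact (mul_eq_zero.mp h1).resolve_left (by exact_mod_cast (Real.exp_pos _).ne')
  -- The exponentials are real, so the real and imaginary parts of `g` are orthogonal to them
  -- separately.
  have hm := (Lp.stronglyMeasurable g).measurable
  have hre : (fun ω => (g ω).re) =ᵐ[P] 0 := by
    refine ae_eq_zero_of_forall_integral_exp_mul_eq_zero hm.re (fun s => ?_) fun s => ?_
    · simpa [-Complex.ofReal_exp] using (hi0 s).re
    · have h1 := congrArg Complex.re (h0 s)
      rw [← RCLike.re_eq_complex_re, ← integral_re (hi0 s)] at h1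
      simpa [-Complex.ofReal_exp] using h1
  have him : (fun ω => (g ω).im) =ᵐ[P] 0 := by
    refine ae_eq_zero_of_forall_integral_exp_mul_eq_zero hm.im (fun s => ?_) fun s => ?_
    · simpa [-Complex.ofReal_exp] using (hi0 s).im
    · have h1 := congrArg Complex.im (h0 s)
      rw [← RCLike.im_eq_complex_im, ← integral_im (hi0 s)] at h1
      simpa [-Complex.ofReal_exp] using h1
  rw [Lp.eq_zero_iff_ae_eq_zero]
  filter_upwards [hre, him] with ω h1 h2
  exact Complex.ext h1 h2

/-! ### Inner products and symmetric tensors in Fock space -/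

section Fock

variable {E : Type*} [NormedAddCommGroup E] [InnerProductSpace ℂ E]

theorem isClosed_symFock : IsClosed (SymFock E : Set (FullFock E)) := by
  have h : (SymFock E : Set (FullFock E))
      = ⋂ n, {x : FullFock E | symmetrizer n (x n) = x n} := by
    ext x
    simp only [Set.mem_iInter]
    rfl
  rw [h]
  refine isClosed_iInter fun n => ?_
  have hc : Continuous fun x : FullFock E => x n :=
    (lp.evalCLM ℂ (fun n : ℕ => HilbertTensorPower E n) 2 n).continuous
  exact isClosed_eq ((symmetrizer n).continuous.comp hc) hc

instance completeSpace_symFock : CompleteSpace (SymFock E) :=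
  isClosed_symFock.completeSpace_coe

theorem inner_tensorPow (h k : E) (n : ℕ) :
    inner ℂ (tensorPow h n) (tensorPow k n) = inner ℂ h k ^ n := by
  rw [tensorPow, tensorPow, UniformSpace.Completion.inner_coe, inner_pureTensor]
  simp

theorem inner_exponential (h k : E) :
    inner ℂ (exponential h) (exponential k) = Complex.exp (inner ℂ h k) := by
  rw [Submodule.coe_inner, lp.inner_eq_tsum, Complex.exp_eq_exp_ℂ, NormedSpace.exp_eq_tsum_div]
  refine tsum_congr fun n => ?_
  change inner ℂ ((Real.sqrt n.factorial : ℂ)⁻¹ • tensorPow h n)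
    ((Real.sqrt n.factorial : ℂ)⁻¹ • tensorPow k n) = _
  rw [inner_smul_left, inner_smul_right, inner_tensorPow, ← Complex.ofReal_inv, Complex.conj_ofReal,
    ← mul_assoc, ← Complex.ofReal_mul, ← mul_inv, Real.mul_self_sqrt (Nat.cast_nonneg _)]
  push_cast
  rw [mul_comm, div_eq_mul_inv]

/-- Permutations act unitarily, so the adjoint of `perm σ` is its inverse; density of the algebraic
tensors extends this to all `x`. -/
theorem inner_perm_pureTensor {n : ℕ} (σ : Equiv.Perm (Fin n)) (x : HilbertTensorPower E n)
    (u : Fin n → E) :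
    inner ℂ (perm σ x) (pureTensor n u : HilbertTensorPower E n)
      = inner ℂ x (pureTensor n (fun i => u (σ i)) : HilbertTensorPower E n) := by
  induction x using UniformSpace.Completion.induction_on with
  | hp => exact isClosed_eq (by fun_prop) (by fun_prop)
  | ih y =>
    have h1 : perm σ (y : HilbertTensorPower E n) = (algPerm σ y : AlgTensorPower E n) :=
      ContinuousLinearMap.completion_apply_coe _ _
    have h2 : algPerm σ (pureTensor n (fun i => u (σ i))) = pureTensor n u := by
      rw [algPerm_pureTensor]
      simp
    rw [h1, UniformSpace.Completion.inner_coe, UniformSpace.Completion.inner_coe, ← h2,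
      inner_algPerm]

theorem inner_pureTensor_eq_average {n : ℕ} {x : HilbertTensorPower E n}
    (hx : symmetrizer n x = x) (u : Fin n → E) :
    inner ℂ x (pureTensor n u : HilbertTensorPower E n) = (n.factorial : ℂ)⁻¹ *
      ∑ σ : Equiv.Perm (Fin n),
        inner ℂ x (pureTensor n (fun i => u (σ i)) : HilbertTensorPower E n) := by
  conv_lhs => rw [← hx]
  simp only [symmetrizer, smul_apply, sum_apply,
    inner_smul_left, sum_inner, inner_perm_pureTensor]
  simp

/-- The multilinear form `u ↦ ⟨x, u₁ ⊗ ⋯ ⊗ uₙ⟩`. -/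
noncomputable def innerPureTensor {n : ℕ} (x : HilbertTensorPower E n) :
    MultilinearMap ℂ (fun _ : Fin n => E) ℂ :=
  ((innerₛₗ ℂ x).comp (UniformSpace.Completion.toComplL
    (𝕜 := ℂ) (E := AlgTensorPower E n)).toLinearMap).compMultilinearMap (pureTensor n)

theorem eq_zero_of_forall_inner_pureTensor {n : ℕ} {x : HilbertTensorPower E n}
    (h : ∀ u : Fin n → E, inner ℂ x (pureTensor n u : HilbertTensorPower E n) = 0) : x = 0 := by
  have h1 : ∀ y : AlgTensorPower E n, inner ℂ x (y : HilbertTensorPower E n) = 0 := by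
    intro y
    induction y using tensor_induction with
    | h0 => rw [UniformSpace.Completion.coe_zero, inner_zero_right]
    | hadd a b ha hb => rw [UniformSpace.Completion.coe_add, inner_add_right, ha, hb, add_zero]
    | hsmul c a ha => rw [UniformSpace.Completion.coe_smul, inner_smul_right, ha, mul_zero]
    | hpure u => exact h u
  have h2 : ∀ y : HilbertTensorPower E n, inner ℂ x y = 0 := by
    intro y
    induction y using UniformSpace.Completion.induction_on with
    | hp => exact isClosed_eq (by fun_prop) (by fun_prop)
    | ih y => exact h1 y
  exact inner_self_eq_zero.mp (h2 x)

/-- A power series in a real variable which sums to `0` everywhere has vanishing coefficients. -/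
theorem eq_zero_of_forall_hasSum_pow_smul {F : Type*} [NormedAddCommGroup F] [NormedSpace ℝ F]
    {b : ℕ → F} (h : ∀ t : ℝ, HasSum (fun n => t ^ n • b n) 0) (n : ℕ) : b n = 0 := by
  let p : FormalMultilinearSeries ℝ ℝ F := fun n => ContinuousMultilinearMap.mkPiRing ℝ (Fin n) (b n)
  have hp : ∀ n, p.coeff n = b n := fun n => by
    simp [p, FormalMultilinearSeries.coeff]
  have h1 : HasFPowerSeriesAt (fun _ : ℝ => (0 : F)) p 0 := by
    rw [hasFPowerSeriesAt_iff]
    exact Eventually.of_forall fun t => by simpa only [hp] using h t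
  have h2 : p = 0 := HasFPowerSeriesAt.eq_zero h1
  rw [← hp, h2]
  rfl

end Fock

/-! ### Polarization and totality of exponential vectors -/

section Complexification

variable {V : Type*} [NormedAddCommGroup V] [InnerProductSpace ℝ V]

/-- The inclusion of a real Hilbert space in its complexification, as a real-linear map. -/
def ofRealLinear : V →ₗ[ℝ] Complexification V where
  toFun := Complexification.ofReal
  map_add' x y := by ext <;> simp [Complexification.ofReal]
  map_smul' r x := by
    change _ = (r : ℂ) • Complexification.ofReal x
    ext
    · rw [Complexification.smul_re]
      simp [Complexification.ofReal]
    · rw [Complexification.smul_im]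
      simp [Complexification.ofReal]

theorem norm_ofReal (x : V) : ‖Complexification.ofReal x‖ = ‖x‖ := by
  rw [@norm_eq_sqrt_re_inner ℂ, Complexification.inner_ofReal, norm_eq_sqrt_real_inner]
  exact congrArg Real.sqrt (Complex.ofReal_re _)

theorem ofReal_add_I_smul (z : Complexification V) :
    Complexification.ofReal z.re + Complex.I • Complexification.ofReal z.im = z := by
  ext <;> simp [Complexification.ofReal]

theorem tensorPow_ofReal_smul (t : ℝ) (d : V) (n : ℕ) :
    tensorPow (Complexification.ofReal (t • d)) n
      = ((t : ℂ) ^ n) • tensorPow (Complexification.ofReal d) n := by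
  have h : Complexification.ofReal (t • d) = (t : ℂ) • Complexification.ofReal d :=
    ofRealLinear.map_smul t d
  rw [tensorPow, tensorPow, h, ← UniformSpace.Completion.coe_smul]
  congr 1
  rw [(pureTensor n).map_smul_univ (fun _ => (t : ℂ)) (fun _ => Complexification.ofReal d)]
  simp

/-- The real multilinear form `v ↦ ⟨x, v₁ ⊗ ⋯ ⊗ vₙ⟩` on a real Hilbert space. -/
noncomputable def tensorForm {n : ℕ} (x : HilbertTensorPower (Complexification V) n) :
    V [×n]→L[ℝ] ℂ :=
  MultilinearMap.mkContinuous
    (((innerPureTensor x).restrictScalars ℝ).compLinearMap fun _ => ofRealLinear) ‖x‖ fun v => by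
    have h : ((innerPureTensor x).restrictScalars ℝ).compLinearMap (fun _ => ofRealLinear) v
        = inner ℂ x ((pureTensor n fun i => Complexification.ofReal (v i) :
          AlgTensorPower (Complexification V) n) : HilbertTensorPower (Complexification V) n) := rfl
    rw [h]
    refine (norm_inner_le_norm _ _).trans (le_of_eq ?_)
    rw [UniformSpace.Completion.norm_coe, norm_pureTensor]
    simp only [norm_ofReal]

theorem tensorForm_apply {n : ℕ} (x : HilbertTensorPower (Complexification V) n) (v : Fin n → V) :
    tensorForm x v = inner ℂ x ((pureTensor n fun i => Complexification.ofReal (v i) :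
      AlgTensorPower (Complexification V) n) : HilbertTensorPower (Complexification V) n) := rfl

/-- Writing each `u i` as `re + i im` and expanding multilinearly leaves only tensors of real
vectors, with powers of `i` as coefficients. -/
theorem eq_zero_of_tensorForm_eq_zero {n : ℕ} {x : HilbertTensorPower (Complexification V) n}
    (h : ∀ v, tensorForm x v = 0) : x = 0 := by
  classical
  refine eq_zero_of_forall_inner_pureTensor fun u => ?_
  have hL : ∀ v : Fin n → V, innerPureTensor x (fun i => Complexification.ofReal (v i)) = 0 := h
  change innerPureTensor x u = 0
  have hu : u = (fun i => Complexification.ofReal (u i).re)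
      + fun i => Complex.I • Complexification.ofReal (u i).im :=
    funext fun i => (ofReal_add_I_smul (u i)).symm
  rw [hu, (innerPureTensor x).map_add_univ]
  refine Finset.sum_eq_zero fun s _ => ?_
  have hs : s.piecewise (fun i => Complexification.ofReal (u i).re)
      (fun i => Complex.I • Complexification.ofReal (u i).im)
      = fun i => (if i ∈ s then 1 else Complex.I) •
        Complexification.ofReal (if i ∈ s then (u i).re else (u i).im) := by
    ext1 i
    by_cases hi : i ∈ s <;> simp [hi]
  rw [hs, (innerPureTensor x).map_smul_univ, hL, smul_zero]

/-- Polarization: a form vanishing on the diagonal has zero symmetrization, and pairing with a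
symmetric tensor already equals its own average over permutations. -/
theorem eq_zero_of_symmetric_of_diagonal {n : ℕ} {x : HilbertTensorPower (Complexification V) n}
    (hx : symmetrizer n x = x) {D : Set V} (hD : Dense D)
    (h : ∀ d ∈ D, tensorForm x (fun _ => d) = 0) : x = 0 := by
  refine eq_zero_of_tensorForm_eq_zero fun v => ?_
  have h1 : (fun d : V => tensorForm x (fun _ => d)) = fun _ => 0 := by
    refine Continuous.ext_on hD ?_ continuous_const h
    exact (tensorForm x).cont.comp (continuous_pi fun _ => continuous_id)
  -- The `n`-th derivative of `d ↦ F(d, …, d)` in directions `v` is the sum of `F` over all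
  -- permutations of `v`.
  have h2 := (tensorForm x).iteratedFDeriv_comp_diagonal 0 v
  rw [h1] at h2
  have h3 : ∑ σ : Equiv.Perm (Fin n), tensorForm x (fun i => v (σ i)) = 0 := by
    rw [← h2]
    simp
  rw [tensorForm_apply, inner_pureTensor_eq_average hx]
  exact mul_eq_zero_of_right _ h3

/-- The exponential vectors of a dense cone of a real Hilbert space are total in the symmetric
Fock space of its complexification. -/
theorem dense_span_exponential {D : Set V} (hD : Dense D)
    (hs : ∀ (t : ℝ), ∀ d ∈ D, t • d ∈ D) :
    Dense (Submodule.span ℂ ((fun d => exponential (Complexification.ofReal d)) '' D) :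
      Set (SymFock (Complexification V))) := by
  refine dense_span_of_forall_inner_eq_zero fun x hx => ?_
  have hx0 : ∀ n, (x : FullFock (Complexification V)) n = 0 := by
    intro n
    refine eq_zero_of_symmetric_of_diagonal (x.2 n) hD fun d hd => ?_
    -- Replacing `d` by `t • d` multiplies the degree `n` term by `t ^ n`; `b n` is the coefficient
    -- of the resulting power series.
    let b : ℕ → ℂ := fun n => (Real.sqrt n.factorial : ℂ)⁻¹ *
      inner ℂ (tensorPow (Complexification.ofReal d) n) ((x : FullFock (Complexification V)) n)
    have hb : ∀ t : ℝ, HasSum (fun n => t ^ n • b n) 0 := by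
      intro t
      rw [← hx _ ⟨t • d, hs t d hd, rfl⟩, Submodule.coe_inner]
      refine (lp.hasSum_inner _ _).congr_fun fun n => ?_
      change t ^ n • b n = inner ℂ ((Real.sqrt n.factorial : ℂ)⁻¹ •
        tensorPow (Complexification.ofReal (t • d)) n) _
      rw [tensorPow_ofReal_smul, inner_smul_left, inner_smul_left, ← Complex.ofReal_inv,
        Complex.conj_ofReal, ← Complex.ofReal_pow, Complex.conj_ofReal, Complex.real_smul]
      simp only [b]
      push_cast
      ring
    have h1 : b n = 0 := eq_zero_of_forall_hasSum_pow_smul hb n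
    have h2 : (Real.sqrt n.factorial : ℂ)⁻¹ ≠ 0 := by
      have := n.factorial_pos
      simp [n.factorial_ne_zero]
    have h3 := (mul_eq_zero.mp h1).resolve_left h2
    rw [inner_eq_zero_symm] at h3
    exact h3
  ext n
  exact hx0 n

end Complexification

/-! ### Exponential vectors over the scaled one-particle space -/

theorem norm_toScaled {V : Type*} [NormedAddCommGroup V] [InnerProductSpace ℝ V]
    (lam : {r : ℝ // 0 < r}) (x : V) : ‖toScaled lam x‖ = (lam : ℝ) * ‖x‖ := by
  rw [@norm_eq_sqrt_real_inner (Scaled lam V), inner_toScaled, real_inner_self_eq_norm_sq,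
    ← mul_pow, Real.sqrt_sq (mul_nonneg lam.2.le (norm_nonneg _))]

theorem continuous_toScaled {V : Type*} [NormedAddCommGroup V] [InnerProductSpace ℝ V]
    (lam : {r : ℝ // 0 < r}) : Continuous (toScaled lam : V → Scaled lam V) :=
  AddMonoidHomClass.continuous_of_bound (toScaled lam) (lam : ℝ) fun x => (norm_toScaled lam x).le

variable (N : GaussianCND) (lam : {r : ℝ // 0 < r})

theorem denseRange_toScaled_phi : DenseRange fun s => toScaled lam (phi N s) :=
  (toScaled lam).surjective.denseRange.comp (denseRange_phi N) (continuous_toScaled lam)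

theorem inner_expPhi (s t : S) : inner ℂ (expPhi N lam s) (expPhi N lam t)
    = Complex.exp (((lam : ℝ) ^ 2 * cndKernel N s t : ℝ) : ℂ) := by
  rw [expPhi, expPhi, inner_exponential, Complexification.inner_ofReal, inner_toScaled, inner_phi]

theorem dense_span_expPhi :
    Dense (Submodule.span ℂ (Set.range (expPhi N lam)) : Set (FockSpace N lam)) := by
  have h := dense_span_exponential (denseRange_toScaled_phi N lam) fun t d hd => by
    obtain ⟨s, rfl⟩ := hd
    exact ⟨t • s, by simp only [phi_smul, map_smul]⟩
  rwa [← Set.range_comp] at h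

end WhiteNoise

end

/-! ### The isomorphism and the obstruction -/

theorem theorem4p2 (N : WhiteNoise.GaussianCND) (lam : {r : ℝ // 0 < r})
    (P : Measure WhiteNoise.TemperedDual) (hP : WhiteNoise.IsWhiteNoiseMeasure N lam P) :
    (∃! W : WhiteNoise.FockSpace N lam ≃ₗᵢ[ℂ] Lp ℂ 2 P, ∀ s : WhiteNoise.S,
      (W (WhiteNoise.expPhi N lam s) : WhiteNoise.TemperedDual → ℂ) =ᵐ[P]
        fun ω => Complex.exp ((ω s - (lam : ℝ) ^ 2 * N s / 2 : ℝ) : ℂ)) ∧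
    ((∃ s : WhiteNoise.S, N s ≠ 0) →
      ¬ ∃ V : WhiteNoise.FockSpace N lam →ₗᵢ[ℂ] Lp ℂ 2 P, ∀ s : WhiteNoise.S,
        (V (WhiteNoise.expPhi N lam s) : WhiteNoise.TemperedDual → ℂ) =ᵐ[P]
          fun ω => Complex.exp ((ω s / Real.sqrt 2 : ℝ) : ℂ)) := by
  have h2 : (∃ s : WhiteNoise.S, N s ≠ 0) →
      ¬ ∃ V : WhiteNoise.FockSpace N lam →ₗᵢ[ℂ] Lp ℂ 2 P, ∀ s : WhiteNoise.S,
        (V (WhiteNoise.expPhi N lam s) : WhiteNoise.TemperedDual → ℂ) =ᵐ[P]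
          fun ω => Complex.exp ((ω s / Real.sqrt 2 : ℝ) : ℂ) := by
    rintro ⟨s, hs⟩ ⟨V, hV⟩
    -- Pairing with the vacuum gives `exp 0 = 1` in Fock space but `E[exp (X_s / √2)] = exp (lam ^ 2
    -- * N s / 4)` in L², forcing `N s = 0`.
    have h1 := V.inner_map_map (WhiteNoise.expPhi N lam 0) (WhiteNoise.expPhi N lam s)
    have h3 : ∀ᵐ ω ∂P, inner ℂ (V (WhiteNoise.expPhi N lam 0) ω) (V (WhiteNoise.expPhi N lam s) ω)
        = ((Real.exp (ω ((1 / Real.sqrt 2) • s)) : ℝ) : ℂ) := by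
      filter_upwards [hV 0, hV s] with ω h0 hs
      rw [h0, hs]
      simp [div_eq_inv_mul]
    rw [L2.inner_def, integral_congr_ae h3, integral_complex_ofReal, hP.integral_exp,
      WhiteNoise.inner_expPhi, ← Complex.ofReal_exp, Complex.ofReal_inj, Real.exp_eq_exp,
      N.map_smul', div_pow, Real.sq_sqrt (by norm_num), WhiteNoise.cndKernel, zero_sub,
      WhiteNoise.GaussianCND.map_neg, WhiteNoise.GaussianCND.map_zero] at h1
    have h4 : (lam : ℝ) ^ 2 * N s = 0 := by linarith
    exact (mul_ne_zero (pow_ne_zero 2 lam.2.ne') hs) h4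
  refine ⟨?_, h2⟩
  obtain ⟨W, hW⟩ := exists_linearIsometryEquiv_of_inner_eq (WhiteNoise.expPhi N lam) hP.expL2
    (WhiteNoise.dense_span_expPhi N lam) hP.dense_span_expL2
    fun s t => by rw [WhiteNoise.inner_expPhi, hP.inner_expL2]
  refine ⟨W, fun s => (hW s).symm ▸ hP.coeFn_expL2 s, fun W' hW' => ?_⟩
  have h3 : ∀ s, W' (WhiteNoise.expPhi N lam s) = W (WhiteNoise.expPhi N lam s) := fun s => by
    rw [hW]
    exact Lp.ext ((hW' s).trans (hP.coeFn_expL2 s).symm)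
  -- Continuous linear maps agreeing on a total family are equal.
  have h4 : W'.toContinuousLinearEquiv.toContinuousLinearMap
      = W.toContinuousLinearEquiv.toContinuousLinearMap :=
    ContinuousLinearMap.ext_on (WhiteNoise.dense_span_expPhi N lam)
      (by rintro _ ⟨s, rfl⟩; exact h3 s)
  exact LinearIsometryEquiv.ext fun x => DFunLike.congr_fun h4 x
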